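/- Let $d\ge 1$ and let $\rho:\mathbb{R}^d\to(0,\infty)$ be a critical radius function, i.e. there are constants $C_0,N_0\ge 1$ such that for all $x,y\in\mathbb{R}^d$ \[C_0^{-1}\rho(x)\left(1+\frac{|x-y|}{\rho(x)}\right)^{-N_0}\le\rho(y)\le C_0\,\rho(x)\left(1+\frac{|x-y|}{\rho(x)}\right)^{\frac{N_0}{N_0+1}}.\] For $x\in\mathbb{R}^d$ and $r>0$, $Q(x,r)$ denotes the cube with sides parallel to the coordinate axes, centre $x$ and side length $\ell(Q)=2r/\sqrt d$. A weight is a locally integrable function $w$ on $\mathbb{R}^d$ with $0<w<\infty$ almost everywhere; we write $w(Q)=\int_Q w$, and $\inf_Q w$ denotes the essential infimum of $w$ on $Q$. Let $u$ be a weight. For $\theta\ge0$, $A_1^{\rho,\theta}(u)$ is the class of weights $w$ for which there is $C>0$ with \[\frac1{u(Q)}\int_Q wu\le C\left(1+\frac r{\rho(x)}\right)^{\theta}\inf_Q w\qquad\text{for every cube }Q=Q(x,r),\] and, for $1<p<\infty$ and $p'=p/(p-1)$, $A_p^{\rho,\theta}(u)$ is the class of weights $w$ for which there is $C>0$ with \[\left(\frac1{u(Q)}\int_Q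 wu\right)^{1/p}\left(\frac1{u(Q)}\int_Q w^{1-p'}u\right)^{1/p'}\le C\left(1+\frac r{\rho(x)}\right)^{\theta}\qquad\text{for every cube }Q=Q(x,r).\] Put $A_p^\rho(u)=\bigcup_{\theta\ge0}A_p^{\rho,\theta}(u)$ for $1\le p<\infty$, $A_\infty^\rho(u)=\bigcup_{1\le p<\infty}A_p^\rho(u)$, and $A_p^\rho=A_p^\rho(1)$ for $1\le p\le\infty$. Let $u\in A_1^\rho$ and let $v$ be a weight. If $uv\in A_\infty^\rho$, then $u\in A_1^\rho(v)$; that is, there exist $C>0$ and $\theta\ge0$ such that \[\frac{uv(Q)}{v(Q)}\le C\left(1+\frac{r}{\rho(x)}\right)^{\theta}\inf_Q u\qquad\text{for every cube }Q=Q(x,r).\] The same conclusion holds if, instead of $uv\in A_\infty^\rho$, one assumes $v\in A_\infty^\rho(u)$. -/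

import Mathlib

open MeasureTheory
open scoped ENNReal

namespace CriticalRadius

/-- `ρ : ℝᵈ → (0, ∞)` is a critical radius function: for some constants `C₀, N₀ ≥ 1`,
`C₀⁻¹ ρ(x) (1 + |x - y| / ρ(x))^(-N₀) ≤ ρ(y) ≤ C₀ ρ(x) (1 + |x - y| / ρ(x))^(N₀ / (N₀ + 1))`
for all `x, y`. (That `C₀ ≥ 1` is forced by taking `x = y`.) -/
def IsCriticalRadius {d : ℕ} (ρ : EuclideanSpace ℝ (Fin d) → ℝ) : Prop :=
  (∀ x, 0 < ρ x) ∧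
    ∃ C₀ N₀ : ℝ, 1 ≤ C₀ ∧ 1 ≤ N₀ ∧ ∀ x y,
      C₀⁻¹ * ρ x * (1 + ‖x - y‖ / ρ x) ^ (-N₀) ≤ ρ y ∧
        ρ y ≤ C₀ * ρ x * (1 + ‖x - y‖ / ρ x) ^ (N₀ / (N₀ + 1))

/-- The cube `Q(x, r)` with sides parallel to the axes, centre `x` and radius `r = √d ℓ(Q) / 2`,
that is, with half side length `ℓ(Q) / 2 = r / √d`. -/
def cube {d : ℕ} (x : EuclideanSpace ℝ (Fin d)) (r : ℝ) : Set (EuclideanSpace ℝ (Fin d)) :=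
  {y | ∀ i, |y i - x i| ≤ r / √(d : ℝ)}

/-- A weight: a locally integrable function which is positive and finite almost everywhere. -/
def IsWeight {d : ℕ} (w : EuclideanSpace ℝ (Fin d) → ℝ≥0∞) : Prop :=
  LocallyIntegrable w volume ∧ ∀ᵐ x, 0 < w x ∧ w x < ∞

/-- The average `(1 / u(Q)) ∫_Q f u` of `f` over `Q` with respect to the weight `u`. -/
noncomputable def wavg {d : ℕ} (u : EuclideanSpace ℝ (Fin d) → ℝ≥0∞)
    (Q : Set (EuclideanSpace ℝ (Fin d))) (f : EuclideanSpace ℝ (Fin d) → ℝ≥0∞) : ℝ≥0∞ :=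
  (∫⁻ y in Q, f y * u y) / (∫⁻ y in Q, u y)

/-- The class `A_1^{ρ,θ}(u)`; the infimum over a cube is the essential infimum. -/
def A1RhoTheta {d : ℕ} (ρ : EuclideanSpace ℝ (Fin d) → ℝ) (θ : ℝ)
    (u : EuclideanSpace ℝ (Fin d) → ℝ≥0∞) : Set (EuclideanSpace ℝ (Fin d) → ℝ≥0∞) :=
  {w | IsWeight w ∧ ∃ C : ℝ, 0 < C ∧ ∀ (x : EuclideanSpace ℝ (Fin d)) (r : ℝ), 0 < r →
    wavg u (cube x r) w ≤
      ENNReal.ofReal (C * (1 + r / ρ x) ^ θ) * essInf w (volume.restrict (cube x r))}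

/-- The class `A_p^{ρ,θ}(u)`, for `1 < p < ∞`; here `p.conjExponent = p / (p - 1)` is `p'`. -/
def ApRhoTheta {d : ℕ} (ρ : EuclideanSpace ℝ (Fin d) → ℝ) (p θ : ℝ)
    (u : EuclideanSpace ℝ (Fin d) → ℝ≥0∞) : Set (EuclideanSpace ℝ (Fin d) → ℝ≥0∞) :=
  {w | IsWeight w ∧ ∃ C : ℝ, 0 < C ∧ ∀ (x : EuclideanSpace ℝ (Fin d)) (r : ℝ), 0 < r →
    (wavg u (cube x r) w) ^ (1 / p) *
        (wavg u (cube x r) (fun y => w y ^ (1 - p.conjExponent))) ^ (1 / p.conjExponent) ≤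
      ENNReal.ofReal (C * (1 + r / ρ x) ^ θ)}

/-- The class `A_1^ρ(u)`, the union of the classes `A_1^{ρ,θ}(u)` over `θ ≥ 0`. -/
def A1Rho {d : ℕ} (ρ : EuclideanSpace ℝ (Fin d) → ℝ)
    (u : EuclideanSpace ℝ (Fin d) → ℝ≥0∞) : Set (EuclideanSpace ℝ (Fin d) → ℝ≥0∞) :=
  ⋃ (θ : ℝ) (_ : 0 ≤ θ), A1RhoTheta ρ θ u

/-- The class `A_p^ρ(u)`, for `1 < p < ∞`: the union of the `A_p^{ρ,θ}(u)` over `θ ≥ 0`. -/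
def ApRho {d : ℕ} (ρ : EuclideanSpace ℝ (Fin d) → ℝ) (p : ℝ)
    (u : EuclideanSpace ℝ (Fin d) → ℝ≥0∞) : Set (EuclideanSpace ℝ (Fin d) → ℝ≥0∞) :=
  ⋃ (θ : ℝ) (_ : 0 ≤ θ), ApRhoTheta ρ p θ u

/-- The class `A_∞^ρ(u)`, the union of the classes `A_p^ρ(u)` over `1 ≤ p < ∞`. -/
def AInftyRho {d : ℕ} (ρ : EuclideanSpace ℝ (Fin d) → ℝ)
    (u : EuclideanSpace ℝ (Fin d) → ℝ≥0∞) : Set (EuclideanSpace ℝ (Fin d) → ℝ≥0∞) :=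
  A1Rho ρ u ∪ ⋃ (p : ℝ) (_ : 1 < p), ApRho ρ p u

end CriticalRadius

/-! Let `A` be the average of `u` over a cube `Q`. By Markov's inequality, `E = {u < 2A} ∩ Q` has at
least half the volume of `Q`. An `A_∞` condition makes this large part carry `uv(Q)` up to a power
of `1 + r/ρ(x)`. On `E` the factor `u` is below `2A`, so `uv(E) ≤ 2A v(Q)`, and `u ∈ A_1^ρ` bounds
`A` by `inf_Q u`.

If `uv ∈ A_∞^ρ`, one transfer from volume to `uv` suffices. If `v ∈ A_∞^ρ(u)`, two are chained:
volume to `u` by the `A_1^ρ` condition, then `u` to `uv`. Both use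
`exists_setLIntegral_le_of_mem_AInftyRho`; the conclusion they share is
`mem_A1Rho_of_large_subsets`. -/

namespace CriticalRadius

/-! ### Transfer of mass between weights, and Markov's inequality -/

section Holder

variable {α : Type*} [MeasurableSpace α] {μ : Measure α} {u w : α → ℝ≥0∞} {p q : ℝ}

/-- Hölder's inequality for the splitting `u = (w u)^(1/p) (w^(1-q) u)^(1/q)`. -/
theorem lintegral_le_weighted_holder (hpq : p.HolderConjugate q) (hu : AEMeasurable u μ)
    (hw : AEMeasurable w μ) (hpos : ∀ᵐ y ∂μ, 0 < w y ∧ w y < ∞) :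
    ∫⁻ y, u y ∂μ ≤
      (∫⁻ y, w y * u y ∂μ) ^ (1 / p) * (∫⁻ y, w y ^ (1 - q) * u y ∂μ) ^ (1 / q) := by
  have hp := hpq.pos
  have hq := hpq.symm.pos
  have key : ∫⁻ y, u y ∂μ = ∫⁻ y, ((fun y => (w y * u y) ^ (1 / p)) *
      fun y => (w y ^ (1 - q) * u y) ^ (1 / q)) y ∂μ := by
    refine lintegral_congr_ae ?_
    filter_upwards [hpos] with y hy
    have hp' : 0 ≤ 1 / p := by positivity
    have hq' : 0 ≤ 1 / q := by positivity
    have hsum : 1 / p + 1 / q = 1 := by simpa using hpq.inv_add_inv_eq_one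
    have hexp : 1 / p + (1 - q) * (1 / q) = 0 := by
      have : (1 - q) * (1 / q) = 1 / q - 1 := by field_simp
      linarith
    simp only [Pi.mul_apply]
    rw [ENNReal.mul_rpow_of_nonneg _ _ hp', ENNReal.mul_rpow_of_nonneg _ _ hq',
      ← ENNReal.rpow_mul, mul_mul_mul_comm, ← ENNReal.rpow_add _ _ hy.1.ne' hy.2.ne,
      ← ENNReal.rpow_add_of_nonneg _ _ hp' hq', hexp, hsum]
    simp
  rw [key]
  refine (ENNReal.lintegral_mul_le_Lp_mul_Lq μ hpq ((hw.mul hu).pow_const _)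
    (((hw.pow_const _).mul hu).pow_const _)).trans_eq ?_
  simp only [← ENNReal.rpow_mul, one_div, inv_mul_cancel₀ hp.ne', inv_mul_cancel₀ hq.ne',
    ENNReal.rpow_one, Pi.mul_apply]

/-- A Muckenhoupt-type `A_p` bound for `w` with respect to `u` on a set transfers the comparability
of `u(Q)` and `u(E)` to that of the weighted integrals of `w`. -/
theorem setLIntegral_le_of_Ap (hpq : p.HolderConjugate q) {Q E : Set α} (hEQ : E ⊆ Q)
    (hu : AEMeasurable u μ) (hw : AEMeasurable w μ) (hpos : ∀ᵐ y ∂μ, 0 < w y ∧ w y < ∞)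
    {K L : ℝ≥0∞} (hu0 : ∫⁻ y in Q, u y ∂μ ≠ 0) (hutop : ∫⁻ y in Q, u y ∂μ ≠ ∞)
    (hK : ((∫⁻ y in Q, w y * u y ∂μ) / ∫⁻ y in Q, u y ∂μ) ^ (1 / p) *
      ((∫⁻ y in Q, w y ^ (1 - q) * u y ∂μ) / ∫⁻ y in Q, u y ∂μ) ^ (1 / q) ≤ K)
    (hL : ∫⁻ y in Q, u y ∂μ ≤ L * ∫⁻ y in E, u y ∂μ) :
    ∫⁻ y in Q, w y * u y ∂μ ≤ (K * L) ^ p * ∫⁻ y in E, w y * u y ∂μ := by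
  have hp := hpq.pos
  have hq := hpq.symm.pos
  have hp' : 0 ≤ 1 / p := by positivity
  have hq' : 0 ≤ 1 / q := by positivity
  have hsum : 1 / p + 1 / q = 1 := by simpa using hpq.inv_add_inv_eq_one
  have hholder := lintegral_le_weighted_holder (μ := μ.restrict E) hpq hu.restrict hw.restrict
    (ae_restrict_of_ae hpos)
  have hS : ∫⁻ y in E, w y ^ (1 - q) * u y ∂μ ≤ ∫⁻ y in Q, w y ^ (1 - q) * u y ∂μ :=
    lintegral_mono_set hEQ
  have hEle : ∫⁻ y in E, u y ∂μ ≤ ∫⁻ y in Q, u y ∂μ := lintegral_mono_set hEQ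
  set m := ∫⁻ y in Q, u y ∂μ
  set e := ∫⁻ y in E, u y ∂μ
  set W := ∫⁻ y in Q, w y * u y ∂μ
  set V := ∫⁻ y in E, w y * u y ∂μ
  set S := ∫⁻ y in Q, w y ^ (1 - q) * u y ∂μ
  -- Even for `L = ∞`, since `∞ * 0 = 0`.
  have he0 : e ≠ 0 := fun h => hu0 (by simpa [h] using hL)
  have hetop : e ≠ ∞ := (hEle.trans_lt hutop.lt_top).ne
  -- The two denominators multiply to `m` because `1/p + 1/q = 1`.
  have hK' : W ^ (1 / p) * S ^ (1 / q) ≤ K * m := by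
    rw [ENNReal.div_rpow_of_nonneg _ _ hp', ENNReal.div_rpow_of_nonneg _ _ hq',
      div_eq_mul_inv (W ^ _), div_eq_mul_inv (S ^ _), mul_mul_mul_comm,
      ← ENNReal.mul_inv (Or.inr (ENNReal.rpow_ne_top_of_nonneg hq' hutop))
        (Or.inl (ENNReal.rpow_ne_top_of_nonneg hp' hutop)),
      ← ENNReal.rpow_add_of_nonneg _ _ hp' hq', hsum, ENNReal.rpow_one, ← div_eq_mul_inv,
      ENNReal.div_le_iff hu0 hutop] at hK
    exact hK
  have hroot : W ^ (1 / p) ≤ K * L * V ^ (1 / p) := by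
    -- Hölder on `E` bounds `e`, the dual integral being enlarged from `E` to `Q`; the `A_p` bound
    -- then yields `m ≤ L * e`, and `e` cancels.
    refine (ENNReal.mul_le_mul_iff_right he0 hetop).1 ?_
    calc e * W ^ (1 / p) ≤ V ^ (1 / p) * S ^ (1 / q) * W ^ (1 / p) := by
          gcongr
          exact hholder.trans (by gcongr)
      _ = V ^ (1 / p) * (W ^ (1 / p) * S ^ (1 / q)) := by ring
      _ ≤ V ^ (1 / p) * (K * m) := by gcongr V ^ (1 / p) * ?_
      _ ≤ V ^ (1 / p) * (K * (L * e)) := by gcongr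
      _ = e * (K * L * V ^ (1 / p)) := by ring
  have := ENNReal.rpow_le_rpow hroot hp.le
  rwa [ENNReal.mul_rpow_of_nonneg _ _ hp.le, ← ENNReal.rpow_mul, ← ENNReal.rpow_mul,
    one_div_mul_cancel hp.ne', ENNReal.rpow_one, ENNReal.rpow_one] at this

/-- The essential infimum over `Q` times the `u`-mass of `E ⊆ Q` bounds `∫_E w u` from below. -/
theorem essInf_mul_setLIntegral_le {Q E : Set α} (hEQ : E ⊆ Q) (hu : AEMeasurable u μ) :
    essInf w (μ.restrict Q) * ∫⁻ y in E, u y ∂μ ≤ ∫⁻ y in E, w y * u y ∂μ := by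
  rw [← lintegral_const_mul'' _ hu.restrict]
  refine lintegral_mono_ae ?_
  filter_upwards [ae_restrict_of_ae_restrict_of_subset hEQ (ae_essInf_le (f := w))] with y hy
  gcongr

/-- Half of the mass of `Q` lies where `u` is less than twice its average. -/
theorem measure_le_two_mul_measure_lt_two_mul_average {Q : Set α} (hQ : NullMeasurableSet Q μ)
    (hu : AEMeasurable u μ) (hQ0 : μ Q ≠ 0) (hQtop : μ Q ≠ ∞)
    (hu0 : ∫⁻ y in Q, u y ∂μ ≠ 0) (hutop : ∫⁻ y in Q, u y ∂μ ≠ ∞) :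
    μ Q ≤ 2 * μ ({y | u y < 2 * ((∫⁻ y in Q, u y ∂μ) / μ Q)} ∩ Q) := by
  set m := ∫⁻ y in Q, u y ∂μ
  set A := m / μ Q
  have hmA : m = A * μ Q := (ENNReal.div_mul_cancel hQ0 hQtop).symm
  have hA0 : A ≠ 0 := ENNReal.div_ne_zero.2 ⟨hu0, hQtop⟩
  have hAtop : A ≠ ∞ := ENNReal.div_ne_top hutop hQ0
  have hmarkov : 2 * μ ({y | 2 * A ≤ u y} ∩ Q) ≤ μ Q := by
    have h := mul_meas_ge_le_lintegral₀ hu.restrict (μ := μ.restrict Q) (2 * A)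
    rw [Measure.restrict_apply₀' hQ] at h
    refine (ENNReal.mul_le_mul_iff_right hA0 hAtop).1 ?_
    calc A * (2 * μ ({y | 2 * A ≤ u y} ∩ Q)) = 2 * A * μ ({y | 2 * A ≤ u y} ∩ Q) := by ring
      _ ≤ m := h
      _ = A * μ Q := hmA
  have hcover : μ Q ≤ μ ({y | u y < 2 * A} ∩ Q) + μ ({y | 2 * A ≤ u y} ∩ Q) := by
    refine (measure_mono fun y hy => ?_).trans (measure_union_le _ _)
    rcases lt_or_ge (u y) (2 * A) with h | h
    exacts [Or.inl ⟨h, hy⟩, Or.inr ⟨h, hy⟩]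
  -- Adding the finite `μ Q` to both sides replaces a subtraction.
  refine (ENNReal.add_le_add_iff_right hQtop).1 ?_
  calc μ Q + μ Q = 2 * μ Q := (two_mul _).symm
    _ ≤ 2 * (μ ({y | u y < 2 * A} ∩ Q) + μ ({y | 2 * A ≤ u y} ∩ Q)) := by gcongr
    _ = 2 * μ ({y | u y < 2 * A} ∩ Q) + 2 * μ ({y | 2 * A ≤ u y} ∩ Q) := mul_add _ _ _
    _ ≤ 2 * μ ({y | u y < 2 * A} ∩ Q) + μ Q := by gcongr

end Holder

/-! ### Cubes: compactness and positive volume -/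

section Cube

variable {d : ℕ}

theorem isCompact_cube (x : EuclideanSpace ℝ (Fin d)) (r : ℝ) : IsCompact (cube x r) := by
  have hc : IsCompact (Set.pi Set.univ fun i => Set.Icc (x i - r / √(d : ℝ)) (x i + r / √(d : ℝ))) :=
    isCompact_univ_pi fun _ => isCompact_Icc
  have h := (PiLp.homeomorph 2 (fun _ : Fin d => ℝ)).isCompact_preimage.2 hc
  convert h using 1
  ext y
  change (∀ i, |y i - x i| ≤ r / √(d : ℝ)) ↔
    ∀ i ∈ Set.univ, y i ∈ Set.Icc (x i - r / √(d : ℝ)) (x i + r / √(d : ℝ))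
  simp only [Set.mem_univ, true_imp_iff, Set.mem_Icc, abs_le]
  refine forall_congr' fun i => ?_
  constructor <;> rintro ⟨h₁, h₂⟩ <;> constructor <;> linarith

theorem ball_subset_cube (x : EuclideanSpace ℝ (Fin d)) (r : ℝ) :
    Metric.ball x (r / √(d : ℝ)) ⊆ cube x r := by
  intro y hy i
  have h := PiLp.norm_apply_le (y - x) i
  rw [mem_ball_iff_norm] at hy
  simpa using h.trans hy.le

theorem volume_cube_ne_zero (hd : 1 ≤ d) (x : EuclideanSpace ℝ (Fin d)) {r : ℝ} (hr : 0 < r) :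
    volume (cube x r) ≠ 0 := by
  have hd' : (0 : ℝ) < d := by exact_mod_cast hd
  have hpos : 0 < r / √(d : ℝ) := by positivity
  exact ((Metric.measure_ball_pos volume x hpos).trans_le
    (measure_mono (ball_subset_cube x r))).ne'

end Cube

/-! ### Weights and the classes attached to `ρ` -/

section Weights

variable {d : ℕ} {u v w : EuclideanSpace ℝ (Fin d) → ℝ≥0∞}

theorem IsWeight.aemeasurable (hw : IsWeight w) : AEMeasurable w volume :=
  hw.1.aestronglyMeasurable.aemeasurable

theorem IsWeight.setLIntegral_cube_ne_top (hw : IsWeight w) (x : EuclideanSpace ℝ (Fin d))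
    (r : ℝ) : ∫⁻ y in cube x r, w y ≠ ∞ := by
  have h := (hw.1.integrableOn_isCompact (isCompact_cube x r)).2
  simpa [HasFiniteIntegral] using h.ne

theorem IsWeight.setLIntegral_cube_ne_zero (hd : 1 ≤ d) (hw : IsWeight w)
    (x : EuclideanSpace ℝ (Fin d)) {r : ℝ} (hr : 0 < r) : ∫⁻ y in cube x r, w y ≠ 0 := by
  intro h
  rw [lintegral_eq_zero_iff' hw.aemeasurable.restrict] at h
  have hfalse : ∀ᵐ y ∂volume.restrict (cube x r), False := by
    filter_upwards [h, ae_restrict_of_ae hw.2] with y h₁ h₂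
    exact h₂.1.ne' h₁
  rw [Filter.eventually_false_iff_eq_bot, ae_eq_bot, Measure.restrict_eq_zero] at hfalse
  exact volume_cube_ne_zero hd x hr hfalse

/-- Makes the unweighted classes an instance of the transfer below, with volume as the reference
mass. -/
theorem isWeight_one : IsWeight (1 : EuclideanSpace ℝ (Fin d) → ℝ≥0∞) :=
  ⟨fun x => ⟨Metric.closedBall x 1, Metric.closedBall_mem_nhds x one_pos, aestronglyMeasurable_const,
    by simp [HasFiniteIntegral, measure_closedBall_lt_top]⟩, by simp⟩

/-- If `w ∈ A_∞^ρ(u)`, then subsets of a cube that are large for `u` are large for `w u`, with a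
polynomial loss. -/
theorem exists_setLIntegral_le_of_mem_AInftyRho (hd : 1 ≤ d)
    {ρ : EuclideanSpace ℝ (Fin d) → ℝ} (hu : IsWeight u) (hw : w ∈ AInftyRho ρ u) :
    ∃ p C θ : ℝ, 1 ≤ p ∧ 0 < C ∧ 0 ≤ θ ∧ ∀ (x : EuclideanSpace ℝ (Fin d)) (r : ℝ), 0 < r →
      ∀ E ⊆ cube x r, ∀ L : ℝ≥0∞, ∫⁻ y in cube x r, u y ≤ L * ∫⁻ y in E, u y →
        ∫⁻ y in cube x r, w y * u y ≤
          (ENNReal.ofReal (C * (1 + r / ρ x) ^ θ) * L) ^ p * ∫⁻ y in E, w y * u y := by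
  rcases hw with hw | hw
  · simp only [A1Rho, Set.mem_iUnion] at hw
    obtain ⟨θ, hθ, -, C, hC, h⟩ := hw
    refine ⟨1, C, θ, le_rfl, hC, hθ, fun x r hr E hE L hL => ?_⟩
    have hx := h x r hr
    rw [wavg, ENNReal.div_le_iff (hu.setLIntegral_cube_ne_zero hd x hr)
      (hu.setLIntegral_cube_ne_top x r)] at hx
    rw [ENNReal.rpow_one]
    set K := ENNReal.ofReal (C * (1 + r / ρ x) ^ θ)
    set I := essInf w (volume.restrict (cube x r))
    calc ∫⁻ y in cube x r, w y * u y ≤ K * I * ∫⁻ y in cube x r, u y := hx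
      _ ≤ K * I * (L * ∫⁻ y in E, u y) := by gcongr
      _ = K * L * (I * ∫⁻ y in E, u y) := by ring
      _ ≤ K * L * ∫⁻ y in E, w y * u y := by
        gcongr
        exact essInf_mul_setLIntegral_le hE hu.aemeasurable
  · simp only [ApRho, Set.mem_iUnion] at hw
    obtain ⟨p, hp, θ, hθ, hw, C, hC, h⟩ := hw
    refine ⟨p, C, θ, hp.le, hC, hθ, fun x r hr E hE L hL => ?_⟩
    exact setLIntegral_le_of_Ap (Real.HolderConjugate.conjExponent hp) hE hu.aemeasurable
      hw.aemeasurable hw.2 (hu.setLIntegral_cube_ne_zero hd x hr)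
      (hu.setLIntegral_cube_ne_top x r) (h x r hr) hL

/-- Combines the comparison of `∫_Q uv` and `∫_E uv`, for every large part `E` of `Q`, with the
`A_1^ρ` condition on `u`. -/
theorem mem_A1Rho_of_large_subsets (hd : 1 ≤ d) {ρ : EuclideanSpace ℝ (Fin d) → ℝ}
    (hρ : ∀ x, 0 < ρ x) (hu : u ∈ A1Rho ρ 1) (hv : IsWeight v)
    (hlarge : ∃ p C θ : ℝ, 0 ≤ p ∧ 0 < C ∧ 0 ≤ θ ∧
      ∀ (x : EuclideanSpace ℝ (Fin d)) (r : ℝ), 0 < r → ∀ E ⊆ cube x r,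
        volume (cube x r) ≤ 2 * volume E →
          ∫⁻ y in cube x r, u y * v y ≤
            ENNReal.ofReal (C * (1 + r / ρ x) ^ θ) ^ p * ∫⁻ y in E, u y * v y) :
    u ∈ A1Rho ρ v ∧
      ∃ C θ : ℝ, 0 < C ∧ 0 ≤ θ ∧ ∀ (x : EuclideanSpace ℝ (Fin d)) (r : ℝ), 0 < r →
        (∫⁻ y in cube x r, u y * v y) / (∫⁻ y in cube x r, v y) ≤
          ENNReal.ofReal (C * (1 + r / ρ x) ^ θ) * essInf u (volume.restrict (cube x r)) := by
  simp only [A1Rho, Set.mem_iUnion] at hu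
  obtain ⟨θ₁, hθ₁, huw, C₁, hC₁, hA1⟩ := hu
  obtain ⟨p, C₂, θ₂, hp, hC₂, hθ₂, hlarge⟩ := hlarge
  have main : ∃ C θ : ℝ, 0 < C ∧ 0 ≤ θ ∧ ∀ (x : EuclideanSpace ℝ (Fin d)) (r : ℝ), 0 < r →
      (∫⁻ y in cube x r, u y * v y) / (∫⁻ y in cube x r, v y) ≤
        ENNReal.ofReal (C * (1 + r / ρ x) ^ θ) * essInf u (volume.restrict (cube x r)) := by
    -- `C₂ ^ p` and `θ₂ * p` come from passing to `E`, the `2` from the level `2 * A`, and `C₁`,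
    -- `θ₁` from the `A_1` bound on `A`.
    refine ⟨C₂ ^ p * 2 * C₁, θ₂ * p + θ₁, by positivity, by positivity, fun x r hr => ?_⟩
    have hmeas : NullMeasurableSet (cube x r) volume :=
      (isCompact_cube x r).measurableSet.nullMeasurableSet
    have hx := hA1 x r hr
    have hhalf := measure_le_two_mul_measure_lt_two_mul_average hmeas huw.aemeasurable
      (volume_cube_ne_zero hd x hr) (isCompact_cube x r).measure_ne_top
      (huw.setLIntegral_cube_ne_zero hd x hr) (huw.setLIntegral_cube_ne_top x r)
    simp only [wavg, Pi.one_apply, mul_one, lintegral_const, Measure.restrict_apply_univ,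
      one_mul] at hx
    set A := (∫⁻ y in cube x r, u y) / volume (cube x r)
    set E := {y | u y < 2 * A} ∩ cube x r
    have hEmeas : NullMeasurableSet E volume :=
      (nullMeasurableSet_lt huw.aemeasurable aemeasurable_const).inter hmeas
    have hE : ∫⁻ y in E, u y * v y ≤ 2 * A * ∫⁻ y in cube x r, v y := by
      calc ∫⁻ y in E, u y * v y ≤ ∫⁻ y in E, 2 * A * v y := by
            refine lintegral_mono_ae ?_
            filter_upwards [ae_restrict_mem₀ hEmeas] with y hy
            gcongr
            exact hy.1.le
        _ = 2 * A * ∫⁻ y in E, v y := lintegral_const_mul'' _ hv.aemeasurable.restrict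
        _ ≤ 2 * A * ∫⁻ y in cube x r, v y := by
            gcongr
            exact Set.inter_subset_right
    have hb := hlarge x r hr E Set.inter_subset_right hhalf
    have ht : 0 < 1 + r / ρ x := by have := hρ x; positivity
    set t := 1 + r / ρ x
    set I := essInf u (volume.restrict (cube x r))
    have hconst : ENNReal.ofReal (C₂ ^ p * 2 * C₁ * t ^ (θ₂ * p + θ₁)) =
        ENNReal.ofReal (C₂ * t ^ θ₂) ^ p * (2 * ENNReal.ofReal (C₁ * t ^ θ₁)) := by
      rw [ENNReal.ofReal_rpow_of_nonneg (by positivity) hp, ← ENNReal.ofReal_ofNat 2,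
        ← ENNReal.ofReal_mul (by norm_num), ← ENNReal.ofReal_mul (by positivity),
        Real.mul_rpow hC₂.le (by positivity), ← Real.rpow_mul ht.le, Real.rpow_add ht]
      congr 1
      ring
    refine ENNReal.div_le_of_le_mul ?_
    calc ∫⁻ y in cube x r, u y * v y
        ≤ ENNReal.ofReal (C₂ * t ^ θ₂) ^ p * ∫⁻ y in E, u y * v y := hb
      _ ≤ ENNReal.ofReal (C₂ * t ^ θ₂) ^ p * (2 * A * ∫⁻ y in cube x r, v y) := by gcongr
      _ ≤ ENNReal.ofReal (C₂ * t ^ θ₂) ^ p *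
          (2 * (ENNReal.ofReal (C₁ * t ^ θ₁) * I) * ∫⁻ y in cube x r, v y) := by gcongr
      _ = ENNReal.ofReal (C₂ ^ p * 2 * C₁ * t ^ (θ₂ * p + θ₁)) * I *
          ∫⁻ y in cube x r, v y := by rw [hconst]; ring
  refine ⟨?_, main⟩
  obtain ⟨C, θ, hC, hθ, h⟩ := main
  simp only [A1Rho, Set.mem_iUnion]
  exact ⟨θ, hθ, huw, C, hC, h⟩

end Weights

end CriticalRadius

theorem mainTheorem5 (d : ℕ) (hd : 1 ≤ d) (ρ : EuclideanSpace ℝ (Fin d) → ℝ)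
    (hρ : CriticalRadius.IsCriticalRadius ρ) (u v : EuclideanSpace ℝ (Fin d) → ℝ≥0∞)
    (hu : u ∈ CriticalRadius.A1Rho ρ 1) (hv : CriticalRadius.IsWeight v) :
    (u * v ∈ CriticalRadius.AInftyRho ρ 1 →
      u ∈ CriticalRadius.A1Rho ρ v ∧
        ∃ C θ : ℝ, 0 < C ∧ 0 ≤ θ ∧ ∀ (x : EuclideanSpace ℝ (Fin d)) (r : ℝ), 0 < r →
          (∫⁻ y in CriticalRadius.cube x r, u y * v y) / (∫⁻ y in CriticalRadius.cube x r, v y) ≤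
            ENNReal.ofReal (C * (1 + r / ρ x) ^ θ) *
              essInf u (volume.restrict (CriticalRadius.cube x r))) ∧
    (v ∈ CriticalRadius.AInftyRho ρ u →
      u ∈ CriticalRadius.A1Rho ρ v ∧
        ∃ C θ : ℝ, 0 < C ∧ 0 ≤ θ ∧ ∀ (x : EuclideanSpace ℝ (Fin d)) (r : ℝ), 0 < r →
          (∫⁻ y in CriticalRadius.cube x r, u y * v y) / (∫⁻ y in CriticalRadius.cube x r, v y) ≤
            ENNReal.ofReal (C * (1 + r / ρ x) ^ θ) *
              essInf u (volume.restrict (CriticalRadius.cube x r))) := by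
  refine ⟨fun h => ?_, fun h => ?_⟩
  · refine CriticalRadius.mem_A1Rho_of_large_subsets hd hρ.1 hu hv ?_
    obtain ⟨p, C, θ, hp, hC, hθ, h⟩ :=
      CriticalRadius.exists_setLIntegral_le_of_mem_AInftyRho hd CriticalRadius.isWeight_one h
    -- The `2` is `L`: `E` fills half of the cube.
    refine ⟨p, C * 2, θ, by linarith, by positivity, hθ, fun x r hr E hE hvol => ?_⟩
    have ht : 0 < 1 + r / ρ x := by have := hρ.1 x; positivity
    have := h x r hr E hE 2 (by simpa using hvol)
    simp only [Pi.mul_apply, Pi.one_apply, mul_one] at this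
    rwa [mul_right_comm, ENNReal.ofReal_mul (by positivity), ENNReal.ofReal_ofNat]
  · refine CriticalRadius.mem_A1Rho_of_large_subsets hd hρ.1 hu hv ?_
    have hu' := CriticalRadius.exists_setLIntegral_le_of_mem_AInftyRho hd
      CriticalRadius.isWeight_one (Or.inl hu)
    have huw : CriticalRadius.IsWeight u := by
      simp only [CriticalRadius.A1Rho, Set.mem_iUnion] at hu
      obtain ⟨_, _, huw, _⟩ := hu
      exact huw
    obtain ⟨q, D, η, hq, hD, hη, hu'⟩ := hu'
    obtain ⟨p, C, θ, hp, hC, hθ, h⟩ :=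
      CriticalRadius.exists_setLIntegral_le_of_mem_AInftyRho hd huw h
    -- The loss `(D * t ^ η * 2) ^ q` of the first transfer, with `t = 1 + r / ρ x`, is the `L` of
    -- the second.
    refine ⟨p, C * (D * 2) ^ q, θ + η * q, by linarith, by positivity, by positivity,
      fun x r hr E hE hvol => ?_⟩
    have ht : 0 < 1 + r / ρ x := by have := hρ.1 x; positivity
    have h₁ := hu' x r hr E hE 2 (by simpa using hvol)
    simp only [Pi.one_apply, mul_one] at h₁
    have h₂ := h x r hr E hE _ h₁
    simp only [mul_comm (v _)] at h₂
    convert h₂ using 3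
    rw [← ENNReal.ofReal_ofNat 2, ← ENNReal.ofReal_mul (by positivity),
      ENNReal.ofReal_rpow_of_nonneg (by positivity) (by linarith),
      ← ENNReal.ofReal_mul (by positivity), mul_right_comm D,
      Real.mul_rpow (x := D * _) (by positivity) (by positivity), ← Real.rpow_mul ht.le,
      Real.rpow_add ht]
    congr 1
    ring
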